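/- Fix a real number $r>3$ and let $S=\{(x,x^r\cos y,x^r\sin y): x>0,\ y\in\mathbb{R}/2\pi\mathbb{Z}\}\subset\mathbb{R}^3$ be the surface of revolution of the profile $\{v=u^r\}$, with the Riemannian metric induced from $\mathbb{R}^3$; its cusp is at $x=0$. For $d_0>0$ let $C=C(d_0)=\{(x,x^r\cos y,x^r\sin y)\in S: x=d_0\}$ be a parallel. For $q=(d_0,d_0^r\cos y,d_0^r\sin y)\in C$ let $V(q)\in T^1_qS$ be the unit vector tangent to the meridian and pointing towards the cusp, and let $JV(q)$ be its rotation by $\pi/2$. Let $M$ be the set of unit vectors $v=\cos\beta\, V(q)+\sin\beta\, JV(q)$ with $q\in C$ and $-\pi/2<\beta<\pi/2$, described by the angular coordinates $(y,\beta)\in\mathbb{R}/2\pi\mathbb{Z}\times(-\pi/2,\pi/2)$ and the distance in these coordinates, and let $\Sigma=\{\beta=0\}\subset M$. For $v\in M\setminus\Sigma$, let $T(v)>0$ be the first time at which the geodesic of $S$ with initial velocity $v$ returns to $C$ (this time exists). For $\nu>0$ and each integer $k\geq 1$ let $$H_k=\Big\{(y,\beta)\in M: \frac{1}{(k+1)^{\nu}}<|\beta|<\frac{1}{k^{\nu}}\Big\}.$$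 Proposition. Given $\nu>0$ and $0<\alpha<1/(\nu+1)$, one has $$\sup_{k\geq 1}\ \|T|_{H_k}\|_{C^\alpha}<\infty$$ whenever $d_0>0$ is sufficiently small (depending on $r$, $\nu$ and $\alpha$), where $\|f\|_{C^\alpha}$ is the sum of $\sup|f|$ and of the least $\alpha$-Hölder constant of $f$. -/

import Mathlib

open scoped NNReal ENNReal

noncomputable section

namespace CuspSurface

/-- Euclidean three-space. -/
abbrev E3 : Type := EuclideanSpace ℝ (Fin 3)

/-- The surface of revolution in `ℝ³` obtained by rotating the profile `v = u ^ r`, `u > 0`, about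
the first coordinate axis, i.e. the points `(x, x ^ r cos y, x ^ r sin y)` with `x > 0`. The cusp is
the missing point at `x = 0`. -/
def surface (r : ℝ) : Set E3 :=
  {p | ∃ (x : ℝ) (y : Real.Angle), 0 < x ∧ p = !₂[x, x ^ r * y.cos, x ^ r * y.sin]}

/-- The parallel `C(d)` of the surface: its points with first coordinate `d`. -/
def parallel (r d : ℝ) : Set E3 := {p | p ∈ surface r ∧ p 0 = d}

/-- A normal vector to the surface at `p`: half of the gradient of `p₁ ² + p₂ ² - p₀ ^ (2 r)`. -/
def normalVector (r : ℝ) (p : E3) : E3 := !₂[-(r * p 0 ^ (2 * r - 1)), p 1, p 2]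

/-- `γ`, restricted to the interval `I`, is a geodesic of the surface (with the metric induced from
`ℝ³`): it is a `C²` curve on the surface whose acceleration is everywhere normal to the surface,
that is, the covariant derivative of its velocity vanishes. -/
structure IsGeodesicOn (r : ℝ) (γ : ℝ → E3) (I : Set ℝ) : Prop where
  contDiffOn : ContDiffOn ℝ 2 γ I
  mem_surface : ∀ t ∈ I, γ t ∈ surface r
  acceleration_normal :
    ∀ t ∈ I, ∃ c : ℝ, derivWithin (derivWithin γ I) I t = c • normalVector r (γ t)

/-- The point of the parallel `C(d)` with angular coordinate `y`. -/
def basePoint (r d : ℝ) (y : Real.Angle) : E3 := !₂[d, d ^ r * y.cos, d ^ r * y.sin]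

/-- The unit vector `V` at `basePoint r d y` tangent to the meridian and pointing to the cusp. -/
def inwardVector (r d : ℝ) (y : Real.Angle) : E3 :=
  -(Real.sqrt (1 + (r * d ^ (r - 1)) ^ 2))⁻¹ •
    !₂[1, r * d ^ (r - 1) * y.cos, r * d ^ (r - 1) * y.sin]

/-- The unit vector `J V` at `basePoint r d y`: the rotation of `V` by `π / 2` in the tangent plane,
counterclockwise for the normal pointing away from the axis of revolution. -/
def rotatedVector (y : Real.Angle) : E3 := !₂[0, -y.sin, y.cos]

/-- The unit tangent vector `v(β) = cos β • V + sin β • J V` at the point of `C(d)` with angular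
coordinate `y`, for the pair of angular coordinates `v = (y, β)`. -/
def initialVector (r d : ℝ) (v : Real.Angle × ℝ) : E3 :=
  Real.cos v.2 • inwardVector r d v.1 + Real.sin v.2 • rotatedVector v.1

/-- The cross-section `M`, in the angular coordinates `(y, β)`: the unit vectors with footprint in
the parallel that point towards the cusp. -/
def crossSection : Set (Real.Angle × ℝ) := {v | |v.2| < Real.pi / 2}

/-- The singular set `Σ` of vectors whose geodesics go straight into the cusp. -/
def singularSet : Set (Real.Angle × ℝ) := {v | v ∈ crossSection ∧ v.2 = 0}

/-- `τ > 0` is the time of first return to `C(d)` of the geodesic with initial vector `v`. -/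
def IsFirstReturnTime (r d : ℝ) (v : Real.Angle × ℝ) (τ : ℝ) : Prop :=
  0 < τ ∧ ∃ γ : ℝ → E3,
    IsGeodesicOn r γ (Set.Icc 0 τ) ∧
    γ 0 = basePoint r d v.1 ∧
    derivWithin γ (Set.Icc 0 τ) 0 = initialVector r d v ∧
    γ τ ∈ parallel r d ∧
    ∀ t ∈ Set.Ioo 0 τ, γ t ∉ parallel r d

/-- The roof function `T`: the first return time to `C(d)`. -/
def roof (r d : ℝ) (v : Real.Angle × ℝ) : ℝ := sInf {τ | IsFirstReturnTime r d v τ}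

/-- The homogeneity strip `H_k` (both connected components), for `k ≥ 1`. -/
def strip (ν : ℝ) (k : ℕ) : Set (Real.Angle × ℝ) :=
  {v | v ∈ crossSection ∧ 1 / ((k : ℝ) + 1) ^ ν < |v.2| ∧ |v.2| < 1 / (k : ℝ) ^ ν}

/-- The Hölder norm `‖f|_s‖_{C^α}`: the supremum norm plus the least Hölder constant
(`∞` if one of them is infinite). -/
def holderNorm {X : Type*} [MetricSpace X] (α : ℝ≥0) (f : X → ℝ) (s : Set X) : ℝ≥0∞ :=
  (⨆ p ∈ s, ‖f p‖ₑ) + eHolderNorm α (fun p : s => f p)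

end CuspSurface

end

noncomputable section

namespace CuspSurface

open Set

/-! Write `ρ = x ^ r` for the distance to the axis. A unit speed geodesic conserves the Clairaut
constant `c = ρ²θ'`, which equals `d ^ r sin β` initially. The signed quantity `σ = ± √(ρ² - c²)`
runs from `-d ^ r cos β` to `d ^ r cos β` between departure and return. It is a better coordinate
than `x`: its speed `ρ_x / √(1 + ρ_x²)`, with `ρ_x = r x ^ (r - 1)`, does not vanish at the turning
point and depends only on `c² + σ²`. Hence the return time is twice the integral over `[0, d ^ r cos
β]` of the reciprocal of this speed.

The integrand decreases in `c² + σ²`, and its value at `c = 0` has an integrable singularity; this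
bounds `T` uniformly (`turningTime_le`). Since the integrand varies no faster than `(c² + σ²) ^
(-1/2)`, multiplying `c` by `m ≥ 1` changes the integral by a factor of at most `m`
(`timeDensity_le_mul`). So `|T(β₁) - T(β₂)|` is at most a constant times the relative increment `(β₂
- β₁) / β₁` (`abs_returnTime_sub_le`). On `H_k` one has `β ~ k ^ (-ν)` and the width is `O(k ^ (-(ν
+ 1)))`, so the relative increment is `O(|β₂ - β₁| ^ α)` uniformly in `k`, because `α (ν + 1) < 1`
(`div_le_rpow_of_mem_strip`).

That the integral is the first return time is proved in both directions: conservation laws force it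
on any returning geodesic (`IsFirstReturnTime.eq_returnTime`), and inverting the integral produces
such a geodesic (`isFirstReturnTime_returnTime`). -/

/-- The reciprocal `dt / dσ` of the speed of `σ = ± √(x ^ (2 r) - c ^ 2)` along a unit speed
geodesic with Clairaut constant `c`, as a function of `w = x ^ (2 r)`. -/
def timeDensity (r w : ℝ) : ℝ := √(1 + (r * w ^ ((r - 1) / (2 * r)))⁻¹ ^ 2)

/-- The time that a unit speed geodesic with Clairaut constant `c` takes from its point closest to
the cusp to the point with `√(x ^ (2 r) - c ^ 2) = σ` (with a sign, for negative `σ`). -/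
def turningTime (r c σ : ℝ) : ℝ := ∫ s in (0 : ℝ)..σ, timeDensity r (c ^ 2 + s ^ 2)

/-- Closed form of the first return time to the parallel `C(d)`, for the initial angle `β`. -/
def returnTime (r d β : ℝ) : ℝ := 2 * turningTime r (d ^ r * Real.sin β) (d ^ r * Real.cos β)

/-! ### The turning time as a function of the radial momentum -/

theorem one_le_timeDensity (r w : ℝ) : 1 ≤ timeDensity r w := by
  rw [timeDensity, Real.one_le_sqrt]
  linarith [sq_nonneg (r * w ^ ((r - 1) / (2 * r)))⁻¹]

theorem timeDensity_pos (r w : ℝ) : 0 < timeDensity r w :=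
  one_pos.trans_le (one_le_timeDensity r w)

theorem timeDensity_rpow {r x : ℝ} (hr : 1 < r) (hx : 0 < x) :
    timeDensity r (x ^ (2 * r)) = √(1 + (r * x ^ (r - 1)) ^ 2) / (r * x ^ (r - 1)) := by
  have hP : 0 < r * x ^ (r - 1) := by positivity
  have h1 : (x ^ (2 * r)) ^ ((r - 1) / (2 * r)) = x ^ (r - 1) := by
    rw [← Real.rpow_mul hx.le]
    congr 1
    field_simp
  rw [timeDensity, h1, eq_div_iff hP.ne']
  nth_rewrite 2 [← Real.sqrt_sq hP.le]
  rw [← Real.sqrt_mul (by positivity)]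
  congr 1
  field_simp
  ring

/-- A nonzero Clairaut constant keeps the base of the power away from `0`, its only singularity. -/
theorem contDiff_timeDensity {r c : ℝ} (hr : 1 < r) (hc : c ≠ 0) {n : WithTop ℕ∞} :
    ContDiff ℝ n (fun s => timeDensity r (c ^ 2 + s ^ 2)) := by
  have hw : ∀ s : ℝ, 0 < c ^ 2 + s ^ 2 := fun s => by positivity
  unfold timeDensity
  refine ContDiff.sqrt ?_ (fun s => by positivity)
  refine contDiff_const.add (ContDiff.pow (ContDiff.inv ?_ fun s => ?_) 2)
  · exact contDiff_const.mul (ContDiff.rpow_const_of_ne (by fun_prop) fun s => (hw s).ne')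
  · have := hw s
    positivity

theorem hasDerivAt_turningTime {r c : ℝ} (hr : 1 < r) (hc : c ≠ 0) (σ : ℝ) :
    HasDerivAt (turningTime r c) (timeDensity r (c ^ 2 + σ ^ 2)) σ :=
  ((contDiff_timeDensity hr hc (n := 0)).continuous).integral_hasStrictDerivAt 0 σ |>.hasDerivAt

theorem turningTime_zero (r c : ℝ) : turningTime r c 0 = 0 := by simp [turningTime]

theorem turningTime_neg (r c σ : ℝ) : turningTime r c (-σ) = -turningTime r c σ := by
  have h := intervalIntegral.integral_comp_neg
    (fun s => timeDensity r (c ^ 2 + s ^ 2)) (a := 0) (b := σ)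
  simp only [neg_sq, neg_zero] at h
  rw [turningTime, turningTime, h, intervalIntegral.integral_symm]

theorem strictMono_turningTime {r c : ℝ} (hr : 1 < r) (hc : c ≠ 0) :
    StrictMono (turningTime r c) :=
  strictMono_of_deriv_pos fun σ => by
    rw [(hasDerivAt_turningTime hr hc σ).deriv]
    exact timeDensity_pos _ _

theorem le_turningTime {r c σ : ℝ} (hr : 1 < r) (hc : c ≠ 0) (hσ : 0 ≤ σ) :
    σ ≤ turningTime r c σ := by
  have h : Monotone fun s => turningTime r c s - s := by
    have hd : ∀ s, HasDerivAt (fun s => turningTime r c s - s)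
        (timeDensity r (c ^ 2 + s ^ 2) - 1) s :=
      fun s => (hasDerivAt_turningTime hr hc s).sub (hasDerivAt_id s)
    refine monotone_of_deriv_nonneg (fun s => (hd s).differentiableAt) fun s => ?_
    rw [(hd s).deriv]
    linarith [one_le_timeDensity r (c ^ 2 + s ^ 2)]
  have := h hσ
  simp only [turningTime_zero] at this
  linarith

theorem surjective_turningTime {r c : ℝ} (hr : 1 < r) (hc : c ≠ 0) :
    Function.Surjective (turningTime r c) := by
  have hcont : Continuous (turningTime r c) :=
    continuous_iff_continuousAt.2 fun s => (hasDerivAt_turningTime hr hc s).continuousAt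
  refine hcont.surjective ?_ ?_
  · refine Filter.tendsto_atTop_mono' _ ?_ Filter.tendsto_id
    filter_upwards [Filter.eventually_ge_atTop 0] with s hs using le_turningTime hr hc hs
  · refine Filter.tendsto_atBot_mono' _ ?_ Filter.tendsto_id
    filter_upwards [Filter.eventually_le_atBot 0] with s hs
    have := le_turningTime hr hc (σ := -s) (by linarith)
    rw [turningTime_neg] at this
    simpa using this

/-! ### Uniform bounds on the return time -/

theorem timeDensity_anti {r w₁ w₂ : ℝ} (hr : 1 < r) (h₁ : 0 < w₁) (h : w₁ ≤ w₂) :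
    timeDensity r w₂ ≤ timeDensity r w₁ := by
  have hb : 0 ≤ (r - 1) / (2 * r) := div_nonneg (by linarith) (by linarith)
  have hw₂ : 0 < w₂ := h₁.trans_le h
  unfold timeDensity
  gcongr

/-- The exponent `(r - 1) / (2 r)` is at most `1 / 2`, so a factor `m ^ 2` in `w` costs at most a
factor `m` in the density. -/
theorem timeDensity_le_mul {r w₁ w₂ m : ℝ} (hr : 1 < r) (h₁ : 0 < w₁) (h₂ : 0 < w₂) (hm : 1 ≤ m)
    (h : w₂ ≤ m ^ 2 * w₁) : timeDensity r w₁ ≤ m * timeDensity r w₂ := by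
  have hb : 0 ≤ (r - 1) / (2 * r) := div_nonneg (by linarith) (by linarith)
  have hb' : (r - 1) / (2 * r) ≤ 1 / 2 := by
    rw [div_le_div_iff₀ (by linarith) two_pos]; linarith
  have hm0 : 0 < m := by linarith
  have key : w₂ ^ ((r - 1) / (2 * r)) ≤ m * w₁ ^ ((r - 1) / (2 * r)) := by
    calc w₂ ^ ((r - 1) / (2 * r)) ≤ (m ^ 2 * w₁) ^ ((r - 1) / (2 * r)) := by gcongr
      _ = (m ^ 2) ^ ((r - 1) / (2 * r)) * w₁ ^ ((r - 1) / (2 * r)) :=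
        Real.mul_rpow (by positivity) h₁.le
      _ ≤ (m ^ 2) ^ (1 / 2 : ℝ) * w₁ ^ ((r - 1) / (2 * r)) := by
        gcongr
        exact one_le_pow₀ hm
      _ = m * w₁ ^ ((r - 1) / (2 * r)) := by
        rw [← Real.sqrt_eq_rpow, Real.sqrt_sq hm0.le]
  have hp₁ : 0 < w₁ ^ ((r - 1) / (2 * r)) := by positivity
  have hp₂ : 0 < w₂ ^ ((r - 1) / (2 * r)) := by positivity
  have hinv : (r * w₁ ^ ((r - 1) / (2 * r)))⁻¹ ≤ m * (r * w₂ ^ ((r - 1) / (2 * r)))⁻¹ := by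
    rw [inv_le_iff_one_le_mul₀ (by positivity)]
    have : m * (r * w₂ ^ ((r - 1) / (2 * r)))⁻¹ * (r * w₁ ^ ((r - 1) / (2 * r)))
        = m * w₁ ^ ((r - 1) / (2 * r)) / w₂ ^ ((r - 1) / (2 * r)) := by
      field_simp
    rw [this, one_le_div hp₂]
    exact key
  unfold timeDensity
  refine Real.sqrt_le_iff.2 ⟨by positivity, ?_⟩
  rw [mul_pow, Real.sq_sqrt (by positivity)]
  have h2 : (r * w₁ ^ ((r - 1) / (2 * r)))⁻¹ ^ 2 ≤ (m * (r * w₂ ^ ((r - 1) / (2 * r)))⁻¹) ^ 2 :=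
    pow_le_pow_left₀ (by positivity) hinv 2
  nlinarith [one_le_pow₀ hm (n := 2)]

/-- This is the case `c = 0`, by `√(1 + q²) ≤ 1 + q`. The majorant is the derivative of `s + s ^
r⁻¹`. -/
theorem timeDensity_sq_le {r s : ℝ} (hr : 1 < r) (hs : 0 < s) :
    timeDensity r (s ^ 2) ≤ 1 + r⁻¹ * s ^ (r⁻¹ - 1) := by
  have hP : (s ^ 2) ^ ((r - 1) / (2 * r)) = s ^ (1 - r⁻¹) := by
    rw [← Real.rpow_natCast, ← Real.rpow_mul hs.le]
    congr 1
    push_cast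
    field_simp
  have hQ : (r * s ^ (1 - r⁻¹))⁻¹ = r⁻¹ * s ^ (r⁻¹ - 1) := by
    rw [mul_inv, ← Real.rpow_neg hs.le, neg_sub]
  rw [timeDensity, hP, hQ]
  refine Real.sqrt_le_iff.2 ⟨by positivity, ?_⟩
  have : 0 ≤ r⁻¹ * s ^ (r⁻¹ - 1) := by positivity
  nlinarith

theorem intervalIntegrable_timeDensity {r c : ℝ} (hr : 1 < r) (hc : c ≠ 0) (a b : ℝ) :
    IntervalIntegrable (fun s => timeDensity r (c ^ 2 + s ^ 2)) MeasureTheory.volume a b :=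
  ((contDiff_timeDensity hr hc (n := 0)).continuous).intervalIntegrable a b

theorem turningTime_le {r c σ : ℝ} (hr : 1 < r) (hc : c ≠ 0) (hσ : 0 ≤ σ) :
    turningTime r c σ ≤ σ + σ ^ r⁻¹ := by
  have hr0 : 0 < r⁻¹ := by positivity
  have hint : IntervalIntegrable (fun s : ℝ => s ^ (r⁻¹ - 1)) MeasureTheory.volume 0 σ :=
    intervalIntegral.intervalIntegrable_rpow' (by linarith)
  have hle : turningTime r c σ ≤ ∫ s in (0 : ℝ)..σ, (1 + r⁻¹ * s ^ (r⁻¹ - 1)) := by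
    refine intervalIntegral.integral_mono_on_of_le_Ioo hσ (intervalIntegrable_timeDensity hr hc _ _)
      (intervalIntegrable_const.add (hint.const_mul _)) fun s hs => ?_
    refine (timeDensity_anti hr (pow_pos hs.1 2) ?_).trans (timeDensity_sq_le hr hs.1)
    linarith [sq_nonneg c]
  refine hle.trans (le_of_eq ?_)
  rw [intervalIntegral.integral_add intervalIntegrable_const (hint.const_mul _),
    intervalIntegral.integral_const_mul, integral_rpow (Or.inl (by linarith))]
  simp [Real.zero_rpow hr0.ne']
  field_simp

theorem returnTime_neg (r d β : ℝ) : returnTime r d (-β) = returnTime r d β := by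
  simp [returnTime, turningTime]

theorem returnTime_abs (r d β : ℝ) : returnTime r d |β| = returnTime r d β := by
  rcases abs_choice β with h | h <;> rw [h]
  exact returnTime_neg r d β

theorem rpow_mul_sin_ne_zero {r d β : ℝ} (hd : 0 < d) (hβ : |β| < Real.pi / 2) (h0 : β ≠ 0) :
    d ^ r * Real.sin β ≠ 0 := by
  rw [abs_lt] at hβ
  have := Real.pi_pos
  refine mul_ne_zero (by positivity) fun h => h0 ?_
  exact (Real.sin_eq_zero_iff_of_lt_of_lt (by linarith) (by linarith)).1 h

theorem rpow_mul_cos_pos {r d β : ℝ} (hd : 0 < d) (hβ : |β| < Real.pi / 2) :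
    0 < d ^ r * Real.cos β := by
  rw [abs_lt] at hβ
  exact mul_pos (by positivity) (Real.cos_pos_of_mem_Ioo ⟨by linarith, by linarith⟩)

theorem returnTime_pos {r d β : ℝ} (hr : 1 < r) (hd : 0 < d) (hβ : |β| < Real.pi / 2)
    (h0 : β ≠ 0) : 0 < returnTime r d β := by
  have := rpow_mul_cos_pos (r := r) hd hβ
  have := le_turningTime hr (rpow_mul_sin_ne_zero (r := r) hd hβ h0) this.le
  unfold returnTime
  linarith

theorem returnTime_le {r d β : ℝ} (hr : 1 < r) (hd : 0 < d) (hβ : |β| < Real.pi / 2)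
    (h0 : β ≠ 0) : returnTime r d β ≤ 2 * (d ^ r + d) := by
  have hpos := rpow_mul_cos_pos (r := r) hd hβ
  have hle : d ^ r * Real.cos β ≤ d ^ r :=
    mul_le_of_le_one_right (by positivity) (Real.cos_le_one β)
  have h2 : (d ^ r * Real.cos β) ^ r⁻¹ ≤ d := by
    calc (d ^ r * Real.cos β) ^ r⁻¹ ≤ (d ^ r) ^ r⁻¹ := by gcongr
      _ = d := Real.rpow_rpow_inv hd.le (by positivity)
  have := turningTime_le hr (rpow_mul_sin_ne_zero (r := r) hd hβ h0) hpos.le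
  unfold returnTime
  linarith

/-! ### Dependence of the return time on the angle -/

/-- The difference of two turning times, for a Clairaut constant that grows by the factor `m` and
a shorter interval. -/
theorem abs_turningTime_sub_le {r c₁ c₂ σ₁ σ₂ : ℝ} (hr : 1 < r) (hc₁ : 0 < c₁) (hc : c₁ ≤ c₂)
    (hσ₂ : 0 < σ₂) (hσ : σ₂ ≤ σ₁) :
    |turningTime r c₁ σ₁ - turningTime r c₂ σ₂| ≤
      (σ₁ - σ₂) * timeDensity r (σ₂ ^ 2) + (c₂ / c₁ - 1) * turningTime r c₂ σ₂ := by
  have hc₂ : 0 < c₂ := hc₁.trans_le hc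
  have hI₁ := intervalIntegrable_timeDensity hr hc₁.ne'
  have hI₂ := intervalIntegrable_timeDensity hr hc₂.ne'
  have hm : 1 ≤ c₂ / c₁ := (one_le_div hc₁).2 hc
  have hsplit : turningTime r c₁ σ₁ - turningTime r c₁ σ₂ =
      ∫ s in σ₂..σ₁, timeDensity r (c₁ ^ 2 + s ^ 2) :=
    intervalIntegral.integral_interval_sub_left (hI₁ _ _) (hI₁ _ _)
  have hup : turningTime r c₁ σ₁ - turningTime r c₁ σ₂ ≤ (σ₁ - σ₂) * timeDensity r (σ₂ ^ 2) := by
    rw [hsplit]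
    calc _ ≤ ∫ _ in σ₂..σ₁, timeDensity r (σ₂ ^ 2) := by
          refine intervalIntegral.integral_mono_on hσ (hI₁ _ _) (by simp) fun s hs => ?_
          refine timeDensity_anti hr (by positivity) ?_
          nlinarith [hs.1, sq_nonneg c₁]
      _ = _ := by simp
  have hlow : 0 ≤ turningTime r c₁ σ₁ - turningTime r c₁ σ₂ :=
    sub_nonneg.2 ((strictMono_turningTime hr hc₁.ne').monotone hσ)
  -- With `m = c₂ / c₁ ≥ 1`, one has `c₂² + s² ≤ m² (c₁² + s²)`, so the densities compare pointwise.
  have hup' : turningTime r c₁ σ₂ ≤ c₂ / c₁ * turningTime r c₂ σ₂ := by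
    unfold turningTime
    rw [← intervalIntegral.integral_const_mul]
    refine intervalIntegral.integral_mono_on hσ₂.le (hI₁ _ _) ((hI₂ _ _).const_mul _) fun s _ => ?_
    refine timeDensity_le_mul hr (by positivity) (by positivity) hm ?_
    have h1 : (c₂ / c₁) ^ 2 * c₁ ^ 2 = c₂ ^ 2 := by field_simp
    nlinarith [one_le_pow₀ hm (n := 2), sq_nonneg s]
  have hlow' : turningTime r c₂ σ₂ ≤ turningTime r c₁ σ₂ := by
    refine intervalIntegral.integral_mono_on hσ₂.le (hI₂ _ _) (hI₁ _ _) fun s _ => ?_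
    refine timeDensity_anti hr (by positivity) ?_
    gcongr
  rw [abs_le]
  constructor
  · have : 0 ≤ (c₂ / c₁ - 1) * turningTime r c₂ σ₂ :=
      mul_nonneg (by linarith) (hσ₂.le.trans (le_turningTime hr hc₂.ne' hσ₂.le))
    have : 0 ≤ (σ₁ - σ₂) * timeDensity r (σ₂ ^ 2) :=
      mul_nonneg (by linarith) (timeDensity_pos _ _).le
    linarith
  · linarith

theorem sin_sub_sin_le {a b : ℝ} (h : a ≤ b) : Real.sin b - Real.sin a ≤ b - a := by
  have := abs_le.1 (Real.abs_sin_sub_sin_le b a)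
  rw [abs_of_nonneg (sub_nonneg.2 h)] at this
  exact this.2

/-- The Clairaut constants have ratio `sin β₂ / sin β₁`, which exceeds `1` by at most twice the
relative increment. The bound `β₂ ≤ 1` keeps the upper endpoint of the integral above `d ^ r cos 1`,
where the density is bounded. -/
theorem abs_returnTime_sub_le {r d β₁ β₂ : ℝ} (hr : 1 < r) (hd : 0 < d) (h₁ : 0 < β₁)
    (h : β₁ ≤ β₂) (h₂ : β₂ ≤ 1) :
    |returnTime r d β₁ - returnTime r d β₂| ≤
      2 * (d ^ r * timeDensity r ((d ^ r * Real.cos 1) ^ 2) + 2 * (d ^ r + d)) *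
        ((β₂ - β₁) / β₁) := by
  have hpi := Real.pi_gt_three
  have hR : 0 < d ^ r := by positivity
  have hβ₂ : |β₂| < Real.pi / 2 := by rw [abs_of_pos (by linarith)]; linarith
  have hs₁ : 0 < Real.sin β₁ := Real.sin_pos_of_pos_of_lt_pi h₁ (by linarith)
  have hs : Real.sin β₁ ≤ Real.sin β₂ :=
    Real.sin_le_sin_of_le_of_le_pi_div_two (by linarith) (by linarith) h
  have hc : Real.cos β₂ ≤ Real.cos β₁ := Real.cos_le_cos_of_nonneg_of_le_pi h₁.le (by linarith) h
  have hc1 : Real.cos 1 ≤ Real.cos β₂ :=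
    Real.cos_le_cos_of_nonneg_of_le_pi (by linarith) (by linarith) h₂
  have hc1' := Real.cos_one_pos
  have key := abs_turningTime_sub_le hr (mul_pos hR hs₁) (mul_le_mul_of_nonneg_left hs hR.le)
    (rpow_mul_cos_pos (r := r) hd hβ₂) (mul_le_mul_of_nonneg_left hc hR.le)
  have hT := returnTime_le hr hd hβ₂ (by linarith)
  have hTpos := returnTime_pos hr hd hβ₂ (by linarith)
  unfold returnTime at hT hTpos ⊢
  rw [← mul_sub, abs_mul, abs_two]
  set A := timeDensity r ((d ^ r * Real.cos 1) ^ 2)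
  have hA : timeDensity r ((d ^ r * Real.cos β₂) ^ 2) ≤ A :=
    timeDensity_anti hr (by positivity) (by gcongr)
  have hA0 : 0 < A := timeDensity_pos _ _
  set x := (β₂ - β₁) / β₁ with hx
  have hx0 : 0 ≤ x := div_nonneg (by linarith) h₁.le
  have hcos : Real.cos β₁ - Real.cos β₂ ≤ x := by
    have h3 := (abs_le.1 (Real.abs_cos_sub_cos_le β₁ β₂)).2
    rw [abs_of_nonpos (by linarith)] at h3
    have : β₂ - β₁ ≤ x := by
      rw [hx, le_div_iff₀ h₁]
      nlinarith
    linarith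
  have hsin : Real.sin β₂ / Real.sin β₁ - 1 ≤ 2 * x := by
    have h4 : Real.sin β₂ / Real.sin β₁ - 1 = (Real.sin β₂ - Real.sin β₁) / Real.sin β₁ := by
      field_simp
    -- The cubic lower bound for the sine on `(0, 1]` is the origin of the factor `2` in `hsin`.
    have h5 : β₁ / 2 ≤ Real.sin β₁ := by
      have := Real.sin_gt_sub_cube h₁
      nlinarith [mul_pos h₁ h₁]
    have h6 := sin_sub_sin_le h
    rw [h4, div_le_iff₀ hs₁]
    have h7 : x * β₁ = β₂ - β₁ := by rw [hx]; field_simp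
    nlinarith
  have hm : d ^ r * Real.sin β₂ / (d ^ r * Real.sin β₁) = Real.sin β₂ / Real.sin β₁ := by
    field_simp
  rw [hm] at key
  set T₂ := turningTime r (d ^ r * Real.sin β₂) (d ^ r * Real.cos β₂)
  have e1 : (d ^ r * Real.cos β₁ - d ^ r * Real.cos β₂) *
      timeDensity r ((d ^ r * Real.cos β₂) ^ 2) ≤ d ^ r * x * A := by
    have : d ^ r * Real.cos β₁ - d ^ r * Real.cos β₂ ≤ d ^ r * x := by nlinarith
    exact mul_le_mul this hA (timeDensity_pos _ _).le (by positivity)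
  have e2 : (Real.sin β₂ / Real.sin β₁ - 1) * T₂ ≤ 2 * x * (d ^ r + d) :=
    mul_le_mul hsin (by linarith) (by linarith) (by positivity)
  nlinarith

/-! ### Conservation laws along an arbitrary geodesic -/

theorem hasDerivWithinAt_coord {γ : ℝ → E3} {γ' : E3} {s : Set ℝ} {t : ℝ}
    (h : HasDerivWithinAt γ γ' s t) (i : Fin 3) :
    HasDerivWithinAt (fun t => γ t i) (γ' i) s t :=
  (EuclideanSpace.proj (𝕜 := ℝ) i).hasFDerivAt.comp_hasDerivWithinAt t h

theorem eq_left_of_hasDerivWithinAt_zero {f : ℝ → ℝ} {τ : ℝ}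
    (h : ∀ t ∈ Icc 0 τ, HasDerivWithinAt f 0 (Icc 0 τ) t) : ∀ t ∈ Icc 0 τ, f t = f 0 := by
  rcases le_or_gt τ 0 with hτ | hτ
  · intro t ht
    rw [le_antisymm (ht.2.trans hτ) ht.1]
  · exact constant_of_derivWithin_zero (fun t ht => (h t ht).differentiableWithinAt)
      fun t ht => (h t (Ico_subset_Icc_self ht)).derivWithin (uniqueDiffOn_Icc hτ t
        (Ico_subset_Icc_self ht))

/-- Expressing every power of the radius through `a` and `a ^ (r - 1)` makes the later identities
polynomial once `a ^ (r - 1)` is generalized. -/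
theorem rpow_two_mul {a r : ℝ} (ha : 0 < a) : a ^ (2 * r) = (a * a ^ (r - 1)) ^ 2 := by
  rw [Real.rpow_sub_one ha.ne', mul_div_cancel₀ _ ha.ne', mul_comm, Real.rpow_mul ha.le]
  norm_num

theorem rpow_two_mul_sub_one {a r : ℝ} (ha : 0 < a) :
    a ^ (2 * r - 1) = a * (a ^ (r - 1)) ^ 2 := by
  rw [Real.rpow_sub_one ha.ne', rpow_two_mul ha]
  field_simp

theorem mul_rpow_sub_one {a r : ℝ} (ha : 0 < a) : a * a ^ (r - 1) = a ^ r := by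
  rw [Real.rpow_sub_one ha.ne', mul_div_cancel₀ _ ha.ne']

theorem surface_pos {r : ℝ} {p : E3} (hp : p ∈ surface r) : 0 < p 0 := by
  obtain ⟨x, y, hx, rfl⟩ := hp
  simpa using hx

theorem surface_eq {r : ℝ} {p : E3} (hp : p ∈ surface r) :
    p 1 ^ 2 + p 2 ^ 2 = p 0 ^ (2 * r) := by
  obtain ⟨x, y, hx, rfl⟩ := hp
  have := Real.Angle.cos_sq_add_sin_sq y
  rw [rpow_two_mul (a := (!₂[x, x ^ r * y.cos, x ^ r * y.sin] : E3) 0) (by simpa using hx)]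
  simp only [Matrix.cons_val, mul_rpow_sub_one hx]
  linear_combination (x ^ r) ^ 2 * this

/-- The quantity `± √(x ^ (2 r) - c ^ 2)`, as a function of `x` and of its velocity. -/
def radialMomentum (r x x' : ℝ) : ℝ := x ^ r * √(1 + (r * x ^ (r - 1)) ^ 2) * x'

/-- Here `l` is the multiplier of the normal vector in the acceleration. The relation `hconstraint`
comes from the twice differentiated surface equation and unit speed; it eliminates both `l` and the
velocity from the derivative. -/
theorem hasDerivWithinAt_radialMomentum {r : ℝ} {a a' : ℝ → ℝ} {a'' : ℝ} {s : Set ℝ} {t : ℝ}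
    (hr : 1 < r) (hpos : 0 < a t)
    (ha : HasDerivWithinAt a (a' t) s t) (ha' : HasDerivWithinAt a' a'' s t) {l : ℝ}
    (hl : a'' = -(l * (r * (a t) ^ (2 * r - 1))))
    (hconstraint : l * (a t) ^ (2 * r) * (1 + (r * (a t) ^ (r - 1)) ^ 2) =
      (r * (2 * r - 1) * (a t ^ (r - 1)) ^ 2 + 1) * a' t ^ 2 - 1) :
    HasDerivWithinAt (fun t => radialMomentum r (a t) (a' t))
      (r * a t ^ (r - 1) / √(1 + (r * a t ^ (r - 1)) ^ 2)) s t := by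
  have hρ : HasDerivWithinAt (fun t => a t ^ r) (a' t * r * a t ^ (r - 1)) s t :=
    ha.rpow_const (Or.inl hpos.ne')
  have hP : HasDerivWithinAt (fun t => a t ^ (r - 1)) (a' t * (r - 1) * a t ^ (r - 1 - 1)) s t :=
    ha.rpow_const (Or.inl hpos.ne')
  have hE0 : 0 < 1 + (r * a t ^ (r - 1)) ^ 2 := by positivity
  have hE : HasDerivWithinAt (fun t => √(1 + (r * a t ^ (r - 1)) ^ 2))
      (2 * (r * a t ^ (r - 1)) * (r * (a' t * (r - 1) * a t ^ (r - 1 - 1))) /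
        (2 * √(1 + (r * a t ^ (r - 1)) ^ 2))) s t := by
    have h := (((hP.const_mul r).fun_pow 2).const_add 1).sqrt hE0.ne'
    simpa using h
  have h := (hρ.fun_mul hE).fun_mul ha'
  refine h.congr_deriv ?_
  rw [hl, rpow_two_mul_sub_one hpos, Real.rpow_sub_one hpos.ne' (r - 1), ← mul_rpow_sub_one (r := r) hpos]
  rw [rpow_two_mul hpos] at hconstraint
  have hEpos := Real.sqrt_pos.2 hE0
  have hEsq := Real.sq_sqrt hE0.le
  have hPpos : 0 < a t ^ (r - 1) := by positivity
  clear h hE hP hρ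
  generalize √(1 + (r * a t ^ (r - 1)) ^ 2) = E at *
  generalize a t ^ (r - 1) = P at *
  field_simp
  linear_combination ((a' t) ^ 2 - l * (a t) ^ 2 * P ^ 2) * hEsq - hconstraint

theorem hasDerivWithinAt_turningTime_radialMomentum {r c : ℝ} {a a' : ℝ → ℝ} {a'' : ℝ} {s : Set ℝ}
    {t : ℝ} (hr : 1 < r) (hc : c ≠ 0) (hpos : 0 < a t)
    (ha : HasDerivWithinAt a (a' t) s t) (ha' : HasDerivWithinAt a' a'' s t) {l : ℝ}
    (hl : a'' = -(l * (r * (a t) ^ (2 * r - 1))))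
    (hconstraint : l * (a t) ^ (2 * r) * (1 + (r * (a t) ^ (r - 1)) ^ 2) =
      (r * (2 * r - 1) * (a t ^ (r - 1)) ^ 2 + 1) * a' t ^ 2 - 1)
    (hc2 : c ^ 2 + radialMomentum r (a t) (a' t) ^ 2 = a t ^ (2 * r)) :
    HasDerivWithinAt (fun t => turningTime r c (radialMomentum r (a t) (a' t))) 1 s t := by
  have h := (hasDerivAt_turningTime hr hc _).comp_hasDerivWithinAt t
    (hasDerivWithinAt_radialMomentum hr hpos ha ha' hl hconstraint)
  refine h.congr_deriv ?_
  rw [hc2, timeDensity_rpow hr hpos]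
  have : 0 < √(1 + (r * a t ^ (r - 1)) ^ 2) := Real.sqrt_pos.2 (by positivity)
  have : 0 < a t ^ (r - 1) := by positivity
  field_simp

/-- Along a unit speed geodesic with Clairaut constant `c`, the turning time of the radial momentum
is an affine function of slope `1`. -/
theorem IsGeodesicOn.turningTime_eq {r τ c : ℝ} {γ : ℝ → E3} (hr : 1 < r) (hτ : 0 < τ)
    (hγ : IsGeodesicOn r γ (Icc 0 τ)) {v : E3} (hv : derivWithin γ (Icc 0 τ) 0 = v)
    (hspeed : v 0 ^ 2 + v 1 ^ 2 + v 2 ^ 2 = 1) (hclairaut : γ 0 1 * v 2 - γ 0 2 * v 1 = c)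
    (hc : c ≠ 0) :
    ∃ u : ℝ → ℝ, u 0 = radialMomentum r (γ 0 0) (v 0) ∧ ∀ t ∈ Icc 0 τ,
      c ^ 2 + u t ^ 2 = γ t 0 ^ (2 * r) ∧ turningTime r c (u t) = turningTime r c (u 0) + t := by
  set I := Icc 0 τ with hI
  have hU : UniqueDiffOn ℝ I := uniqueDiffOn_Icc hτ
  set V := derivWithin γ I with hV
  have hd : ∀ t ∈ I, HasDerivWithinAt γ (V t) I t := fun t ht =>
    (hγ.contDiffOn.differentiableOn (by norm_num) t ht).hasDerivWithinAt
  have hVd : DifferentiableOn ℝ V I :=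
    (hγ.contDiffOn.derivWithin (m := 1) hU (by norm_num)).differentiableOn (by norm_num)
  have hpos : ∀ t ∈ I, 0 < γ t 0 := fun t ht => surface_pos (hγ.mem_surface t ht)
  have hsurf : ∀ t ∈ I, γ t 1 ^ 2 + γ t 2 ^ 2 = γ t 0 ^ (2 * r) :=
    fun t ht => surface_eq (hγ.mem_surface t ht)
  have hacc : ∀ t ∈ I, ∃ l : ℝ, HasDerivWithinAt V (l • normalVector r (γ t)) I t := by
    intro t ht
    obtain ⟨l, hl⟩ := hγ.acceleration_normal t ht
    exact ⟨l, hl ▸ (hVd t ht).hasDerivWithinAt⟩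
  choose! l hl using hacc
  have hd' : ∀ i, ∀ t ∈ I, HasDerivWithinAt (fun t => γ t i) (V t i) I t :=
    fun i t ht => hasDerivWithinAt_coord (hd t ht) i
  have hV0 : ∀ t ∈ I, HasDerivWithinAt (fun t => V t 0) (-(l t * (r * γ t 0 ^ (2 * r - 1)))) I t :=
    fun t ht => (hasDerivWithinAt_coord (hl t ht) 0).congr_deriv (by simp [normalVector])
  have hV1 : ∀ t ∈ I, HasDerivWithinAt (fun t => V t 1) (l t * γ t 1) I t :=
    fun t ht => (hasDerivWithinAt_coord (hl t ht) 1).congr_deriv (by simp [normalVector])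
  have hV2 : ∀ t ∈ I, HasDerivWithinAt (fun t => V t 2) (l t * γ t 2) I t :=
    fun t ht => (hasDerivWithinAt_coord (hl t ht) 2).congr_deriv (by simp [normalVector])
  have h0 : (0 : ℝ) ∈ I := ⟨le_rfl, hτ.le⟩
  have hV_zero : V 0 = v := hv
  -- the velocity is tangent to the surface
  have htan : ∀ t ∈ I, γ t 1 * V t 1 + γ t 2 * V t 2 = r * γ t 0 ^ (2 * r - 1) * V t 0 := by
    intro t ht
    have e1 := ((hd' 1 t ht).fun_pow 2).fun_add ((hd' 2 t ht).fun_pow 2)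
    have e2 : HasDerivWithinAt (fun t => γ t 0 ^ (2 * r)) _ I t :=
      (hd' 0 t ht).rpow_const (p := 2 * r) (Or.inl (hpos t ht).ne')
    have e3 := e2.congr (f₁ := fun t => γ t 1 ^ 2 + γ t 2 ^ 2) hsurf (hsurf t ht)
    have e4 := (hU t ht).eq_deriv _ e1 e3
    norm_num at e4
    linarith
  -- Differentiating the tangency relation determines the multiplier `l`.
  have htan' : ∀ t ∈ I, V t 1 ^ 2 + V t 2 ^ 2 + l t * γ t 0 ^ (2 * r) =
      r * (2 * r - 1) * (γ t 0 ^ (r - 1)) ^ 2 * V t 0 ^ 2 -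
        r ^ 2 * l t * (γ t 0 ^ (2 * r - 1)) ^ 2 := by
    intro t ht
    have e1 := ((hd' 1 t ht).fun_mul (hV1 t ht)).fun_add ((hd' 2 t ht).fun_mul (hV2 t ht))
    have e2 : HasDerivWithinAt (fun t => γ t 0 ^ (2 * r - 1)) _ I t :=
      (hd' 0 t ht).rpow_const (p := 2 * r - 1) (Or.inl (hpos t ht).ne')
    have e3 := ((e2.const_mul r).fun_mul (hV0 t ht)).congr
      (f₁ := fun t => γ t 1 * V t 1 + γ t 2 * V t 2) htan (htan t ht)
    have e4 := (hU t ht).eq_deriv _ e1 e3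
    rw [Real.rpow_sub_one (hpos t ht).ne' (2 * r - 1), rpow_two_mul_sub_one (hpos t ht)] at e4
    rw [rpow_two_mul_sub_one (hpos t ht), ← hsurf t ht]
    have := hpos t ht
    field_simp at e4
    linear_combination e4
  have henergy : ∀ t ∈ I, V t 0 ^ 2 + V t 1 ^ 2 + V t 2 ^ 2 = 1 := by
    intro t ht
    have key := eq_left_of_hasDerivWithinAt_zero
      (f := fun t => V t 0 ^ 2 + V t 1 ^ 2 + V t 2 ^ 2) (τ := τ) (fun t ht => by
        refine ((((hV0 t ht).fun_pow 2).fun_add ((hV1 t ht).fun_pow 2)).fun_add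
          ((hV2 t ht).fun_pow 2)).congr_deriv ?_
        norm_num
        linear_combination 2 * l t * htan t ht) t ht
    simp only [hV_zero] at key
    rw [key, hspeed]
  have hcl : ∀ t ∈ I, γ t 1 * V t 2 - γ t 2 * V t 1 = c := by
    intro t ht
    have key := eq_left_of_hasDerivWithinAt_zero
      (f := fun t => γ t 1 * V t 2 - γ t 2 * V t 1) (τ := τ) (fun t ht => by
        refine (((hd' 1 t ht).fun_mul (hV2 t ht)).fun_sub
          ((hd' 2 t ht).fun_mul (hV1 t ht))).congr_deriv ?_
        ring) t ht
    simp only [hV_zero] at key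
    rw [key, hclairaut]
  have hmom : ∀ t ∈ I, c ^ 2 + radialMomentum r (γ t 0) (V t 0) ^ 2 = γ t 0 ^ (2 * r) := by
    intro t ht
    have e1 := henergy t ht
    have e2 := htan t ht
    have e3 := hsurf t ht
    have e4 := hpos t ht
    rw [rpow_two_mul_sub_one e4] at e2
    rw [rpow_two_mul e4] at e3 ⊢
    rw [radialMomentum, ← mul_rpow_sub_one e4, mul_pow, mul_pow, Real.sq_sqrt (by positivity),
      ← hcl t ht]
    have hP : 0 < γ t 0 ^ (r - 1) := by positivity
    generalize γ t 0 ^ (r - 1) = P at *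
    -- Lagrange's identity expresses the square of the Clairaut constant through the energy and the
    -- tangency relation.
    have e5 : (γ t 1 * V t 2 - γ t 2 * V t 1) ^ 2 =
        (γ t 1 ^ 2 + γ t 2 ^ 2) * (V t 1 ^ 2 + V t 2 ^ 2) -
          (γ t 1 * V t 1 + γ t 2 * V t 2) ^ 2 := by ring
    rw [e5, e2, e3]
    linear_combination (γ t 0 * P) ^ 2 * e1
  refine ⟨fun t => radialMomentum r (γ t 0) (V t 0), by simp [hV_zero], fun t ht =>
    ⟨hmom t ht, ?_⟩⟩
  have key := eq_left_of_hasDerivWithinAt_zero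
    (f := fun t => turningTime r c (radialMomentum r (γ t 0) (V t 0)) - t) (τ := τ) (fun t ht => by
      have h := (hasDerivWithinAt_turningTime_radialMomentum (a := fun t => γ t 0)
        (a' := fun t => V t 0) hr hc (hpos t ht) (hd' 0 t ht) (hV0 t ht) rfl ?_
        (hmom t ht)).fun_sub (hasDerivWithinAt_id t I)
      · exact h.congr_deriv (sub_self 1)
      · have e1 := henergy t ht
        have e2 := htan' t ht
        have e4 := hpos t ht
        rw [rpow_two_mul_sub_one e4, rpow_two_mul e4] at e2
        rw [rpow_two_mul e4]
        linear_combination e2 - e1) t ht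
  simp only at key
  linarith

/-! ### Initial data and uniqueness of the return time -/

theorem basePoint_zero (r d : ℝ) (y : Real.Angle) : basePoint r d y 0 = d := rfl

theorem initialVector_zero (r d : ℝ) (v : Real.Angle × ℝ) :
    initialVector r d v 0 = -(Real.cos v.2 / √(1 + (r * d ^ (r - 1)) ^ 2)) := by
  simp [initialVector, inwardVector, rotatedVector, div_eq_mul_inv]

theorem initialVector_one (r d : ℝ) (v : Real.Angle × ℝ) :
    initialVector r d v 1 = -(Real.cos v.2 / √(1 + (r * d ^ (r - 1)) ^ 2)) *
      (r * d ^ (r - 1)) * v.1.cos - Real.sin v.2 * v.1.sin := by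
  simp [initialVector, inwardVector, rotatedVector]
  ring

theorem initialVector_two (r d : ℝ) (v : Real.Angle × ℝ) :
    initialVector r d v 2 = -(Real.cos v.2 / √(1 + (r * d ^ (r - 1)) ^ 2)) *
      (r * d ^ (r - 1)) * v.1.sin + Real.sin v.2 * v.1.cos := by
  simp [initialVector, inwardVector, rotatedVector]
  ring

theorem norm_initialVector (r d : ℝ) (v : Real.Angle × ℝ) :
    initialVector r d v 0 ^ 2 + initialVector r d v 1 ^ 2 + initialVector r d v 2 ^ 2 = 1 := by
  rw [initialVector_zero, initialVector_one, initialVector_two]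
  have hE : 0 < 1 + (r * d ^ (r - 1)) ^ 2 := by positivity
  have h1 := Real.sq_sqrt hE.le
  have h2 := Real.sqrt_pos.2 hE
  have h3 := Real.Angle.cos_sq_add_sin_sq v.1
  have h4 := Real.sin_sq_add_cos_sq v.2
  generalize √(1 + (r * d ^ (r - 1)) ^ 2) = E at *
  have h5 : (Real.cos v.2 / E) ^ 2 * (1 + (r * d ^ (r - 1)) ^ 2) = Real.cos v.2 ^ 2 := by
    rw [← h1]; field_simp
  linear_combination ((Real.cos v.2 / E) ^ 2 * (r * d ^ (r - 1)) ^ 2 + Real.sin v.2 ^ 2) * h3 +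
    h5 + h4

theorem clairaut_initialVector (r d : ℝ) (v : Real.Angle × ℝ) :
    basePoint r d v.1 1 * initialVector r d v 2 - basePoint r d v.1 2 * initialVector r d v 1 =
      d ^ r * Real.sin v.2 := by
  rw [initialVector_one, initialVector_two]
  simp only [basePoint, Matrix.cons_val]
  linear_combination d ^ r * Real.sin v.2 * Real.Angle.cos_sq_add_sin_sq v.1

theorem radialMomentum_initialVector (r d : ℝ) (v : Real.Angle × ℝ) :
    radialMomentum r d (initialVector r d v 0) = -(d ^ r * Real.cos v.2) := by
  have hE : 0 < √(1 + (r * d ^ (r - 1)) ^ 2) := Real.sqrt_pos.2 (by positivity)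
  rw [radialMomentum, initialVector_zero]
  field_simp

/-- On the parallel the radial momentum can only be `± d ^ r cos β`, and the turning time advances
at unit rate. No uniqueness theorem for the geodesic equation is needed. -/
theorem IsFirstReturnTime.eq_returnTime {r d τ : ℝ} {v : Real.Angle × ℝ} (hr : 1 < r) (hd : 0 < d)
    (hv : |v.2| < Real.pi / 2) (hv0 : v.2 ≠ 0) (h : IsFirstReturnTime r d v τ) :
    τ = returnTime r d v.2 := by
  obtain ⟨hτ, γ, hγ, hγ0, hγ', hend, -⟩ := h
  have hc := rpow_mul_sin_ne_zero (r := r) hd hv hv0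
  obtain ⟨u, hu0, hu⟩ := hγ.turningTime_eq hr hτ hγ' (norm_initialVector r d v)
    (by rw [hγ0, clairaut_initialVector]) hc
  rw [hγ0, basePoint_zero, radialMomentum_initialVector] at hu0
  obtain ⟨h1, h2⟩ := hu τ ⟨hτ.le, le_rfl⟩
  rw [hend.2, rpow_two_mul hd, mul_rpow_sub_one hd] at h1
  rw [hu0, turningTime_neg] at h2
  have h3 : u τ ^ 2 = (d ^ r * Real.cos v.2) ^ 2 := by
    linear_combination h1 - (d ^ r) ^ 2 * Real.sin_sq_add_cos_sq v.2
  rcases sq_eq_sq_iff_eq_or_eq_neg.1 h3 with h4 | h4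
  · rw [h4] at h2
    unfold returnTime
    linarith
  -- The initial value of the momentum would recur, giving `τ = 0`.
  · rw [h4, turningTime_neg] at h2
    linarith

/-! ### Construction of geodesics by quadrature -/

/-- The inverse of the turning time. -/
theorem exists_inverse_turningTime {r c : ℝ} (hr : 1 < r) (hc : c ≠ 0) :
    ∃ u : ℝ → ℝ, (∀ s, u (turningTime r c s) = s) ∧ (∀ t, turningTime r c (u t) = t) ∧
      ∀ t, HasDerivAt u (timeDensity r (c ^ 2 + u t ^ 2))⁻¹ t := by
  set e := (strictMono_turningTime hr hc).orderIsoOfSurjective _ (surjective_turningTime hr hc)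
    with he
  have h1 : ∀ t, turningTime r c (e.symm t) = t := fun t => e.apply_symm_apply t
  refine ⟨e.symm, fun s => e.symm_apply_apply s, h1, fun t => ?_⟩
  exact HasDerivAt.of_local_left_inverse e.symm.continuous.continuousAt
    (hasDerivAt_turningTime hr hc _) (timeDensity_pos _ _).ne' (Filter.Eventually.of_forall h1)

theorem contDiff_two_of_hasDerivAt_comp {u g : ℝ → ℝ} (hg : ContDiff ℝ 1 g)
    (hu : ∀ t, HasDerivAt u (g (u t)) t) : ContDiff ℝ 2 u := by
  have hdiff : Differentiable ℝ u := fun t => (hu t).differentiableAt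
  have hderiv : deriv u = fun t => g (u t) := funext fun t => (hu t).deriv
  have h1 : ContDiff ℝ 1 u := by
    rw [contDiff_one_iff_deriv, hderiv]
    exact ⟨hdiff, hg.continuous.comp hdiff.continuous⟩
  rw [show (2 : WithTop ℕ∞) = 1 + 1 by norm_num, contDiff_succ_iff_deriv, hderiv]
  exact ⟨hdiff, by simp, hg.comp h1⟩

/-- The point of the surface with first coordinate `x` and angle `θ`. -/
def surfacePoint (r x θ : ℝ) : E3 := !₂[x, x ^ r * Real.cos θ, x ^ r * Real.sin θ]

theorem surfacePoint_mem {r x θ : ℝ} (hx : 0 < x) : surfacePoint r x θ ∈ surface r :=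
  ⟨x, θ, hx, by simp [surfacePoint]⟩

theorem hasDerivAt_toE3 {f₀ f₁ f₂ : ℝ → ℝ} {a b c t : ℝ} (h₀ : HasDerivAt f₀ a t)
    (h₁ : HasDerivAt f₁ b t) (h₂ : HasDerivAt f₂ c t) :
    HasDerivAt (fun t => (!₂[f₀ t, f₁ t, f₂ t] : E3)) !₂[a, b, c] t := by
  have h : HasDerivAt (fun t => (![f₀ t, f₁ t, f₂ t] : Fin 3 → ℝ)) ![a, b, c] t := by
    rw [hasDerivAt_pi]
    intro i
    fin_cases i
    exacts [h₀, h₁, h₂]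
  exact (PiLp.continuousLinearEquiv 2 ℝ (fun _ : Fin 3 => ℝ)).symm.hasFDerivAt.comp_hasDerivAt t h

theorem contDiff_toE3 {n : WithTop ℕ∞} {f₀ f₁ f₂ : ℝ → ℝ} (h₀ : ContDiff ℝ n f₀)
    (h₁ : ContDiff ℝ n f₁) (h₂ : ContDiff ℝ n f₂) :
    ContDiff ℝ n (fun t => (!₂[f₀ t, f₁ t, f₂ t] : E3)) := by
  rw [contDiff_euclidean]
  intro i
  fin_cases i
  exacts [h₀, h₁, h₂]

/-- The distance to the cusp along a geodesic, in terms of the radial momentum `s`. -/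
def radius (r c s : ℝ) : ℝ := (c ^ 2 + s ^ 2) ^ (2 * r)⁻¹

theorem radius_pos {r c s : ℝ} (hc : c ≠ 0) : 0 < radius r c s := by
  have : 0 < c ^ 2 + s ^ 2 := by positivity
  exact Real.rpow_pos_of_pos this _

theorem radius_rpow {r c s : ℝ} (hr : 1 < r) : radius r c s ^ (2 * r) = c ^ 2 + s ^ 2 :=
  Real.rpow_inv_rpow (by positivity) (by positivity)

theorem radius_sq {r c s : ℝ} (hr : 1 < r) (hc : c ≠ 0) :
    (radius r c s ^ r) ^ 2 = c ^ 2 + s ^ 2 := by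
  rw [← radius_rpow hr, rpow_two_mul (radius_pos hc), mul_rpow_sub_one (radius_pos hc)]

/-- The first velocity component of a geodesic as a function of its radial momentum. -/
def radialSpeed (r c s : ℝ) : ℝ :=
  s / (radius r c s ^ r * √(1 + (r * radius r c s ^ (r - 1)) ^ 2))

theorem inv_timeDensity {r c s : ℝ} (hr : 1 < r) (hc : c ≠ 0) :
    (timeDensity r (c ^ 2 + s ^ 2))⁻¹ =
      r * radius r c s ^ (r - 1) / √(1 + (r * radius r c s ^ (r - 1)) ^ 2) := by
  rw [← radius_rpow hr, timeDensity_rpow hr (radius_pos hc), inv_div]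

theorem hasDerivAt_radius {r c : ℝ} {u : ℝ → ℝ} {t : ℝ} (hr : 1 < r) (hc : c ≠ 0)
    (hu : HasDerivAt u (timeDensity r (c ^ 2 + u t ^ 2))⁻¹ t) :
    HasDerivAt (fun t => radius r c (u t)) (radialSpeed r c (u t)) t := by
  have hw : 0 < c ^ 2 + u t ^ 2 := by positivity
  have h := ((hu.fun_pow 2).const_add (c ^ 2)).rpow_const (p := (2 * r)⁻¹) (Or.inl hw.ne')
  refine h.congr_deriv ?_
  have hx := radius_pos (r := r) (s := u t) hc
  have hE : 0 < √(1 + (r * radius r c (u t) ^ (r - 1)) ^ 2) := Real.sqrt_pos.2 (by positivity)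
  have hP : 0 < radius r c (u t) ^ (r - 1) := by positivity
  rw [inv_timeDensity hr hc, radialSpeed, Real.rpow_sub_one hw.ne', ← radius, ← radius_rpow hr,
    rpow_two_mul hx, ← mul_rpow_sub_one (r := r) hx]
  generalize √(1 + (r * radius r c (u t) ^ (r - 1)) ^ 2) = E at *
  generalize radius r c (u t) ^ (r - 1) = P at *
  have hr0 : r ≠ 0 := by positivity
  field_simp
  ring

/-- The derivative of the first velocity component. -/
def radialAcceleration (r c s : ℝ) : ℝ :=
  r * radius r c s ^ (r - 1) / (√(1 + (r * radius r c s ^ (r - 1)) ^ 2)) ^ 2 *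
    (c ^ 2 / (radius r c s ^ r) ^ 3 - r * (r - 1) * radius r c s ^ (r - 2) *
      radialSpeed r c s ^ 2)

theorem hasDerivAt_radialSpeed {r c : ℝ} {u : ℝ → ℝ} {t : ℝ} (hr : 1 < r) (hc : c ≠ 0)
    (hu : HasDerivAt u (timeDensity r (c ^ 2 + u t ^ 2))⁻¹ t) :
    HasDerivAt (fun t => radialSpeed r c (u t)) (radialAcceleration r c (u t)) t := by
  have hx := radius_pos (r := r) (s := u t) hc
  have ha := hasDerivAt_radius hr hc hu
  have hρ : HasDerivAt (fun t => radius r c (u t) ^ r)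
      (radialSpeed r c (u t) * r * radius r c (u t) ^ (r - 1)) t :=
    ha.rpow_const (Or.inl hx.ne')
  have hP : HasDerivAt (fun t => radius r c (u t) ^ (r - 1))
      (radialSpeed r c (u t) * (r - 1) * radius r c (u t) ^ (r - 1 - 1)) t :=
    ha.rpow_const (Or.inl hx.ne')
  have hE0 : 0 < 1 + (r * radius r c (u t) ^ (r - 1)) ^ 2 := by positivity
  have hE : HasDerivAt (fun t => √(1 + (r * radius r c (u t) ^ (r - 1)) ^ 2))
      (2 * (r * radius r c (u t) ^ (r - 1)) *
        (r * (radialSpeed r c (u t) * (r - 1) * radius r c (u t) ^ (r - 1 - 1))) /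
        (2 * √(1 + (r * radius r c (u t) ^ (r - 1)) ^ 2))) t := by
    have h := (((hP.const_mul r).fun_pow 2).const_add 1).sqrt hE0.ne'
    simpa using h
  have hEpos := Real.sqrt_pos.2 hE0
  have hρpos : 0 < radius r c (u t) ^ r := by positivity
  have h := hu.fun_div (hρ.fun_mul hE) (by positivity)
  refine h.congr_deriv ?_
  have hEsq := Real.sq_sqrt hE0.le
  have hPpos : 0 < radius r c (u t) ^ (r - 1) := by positivity
  have hw := radius_sq (r := r) (s := u t) hr hc
  rw [inv_timeDensity hr hc, radialAcceleration, show r - 2 = r - 1 - 1 by ring,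
    Real.rpow_sub_one hx.ne' (r - 1), radialSpeed]
  rw [← mul_rpow_sub_one (r := r) hx] at hw ⊢
  clear h hE hP hρ ha hu hρpos
  generalize √(1 + (r * radius r c (u t) ^ (r - 1)) ^ 2) = E at *
  generalize radius r c (u t) ^ (r - 1) = P at *
  generalize radius r c (u t) = x at *
  field_simp
  linear_combination E ^ 2 * hw

/-- A curve on the surface whose radial momentum `u` and angle `θ` satisfy the geodesic equations of
Clairaut constant `c`. -/
structure IsClairautCurve (r c : ℝ) (u θ : ℝ → ℝ) : Prop where
  hasDerivAt_momentum : ∀ t, HasDerivAt u (timeDensity r (c ^ 2 + u t ^ 2))⁻¹ t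
  hasDerivAt_angle : ∀ t, HasDerivAt θ (c / (c ^ 2 + u t ^ 2)) t

/-- The velocity of a Clairaut curve. -/
def clairautVelocity (r c s θ : ℝ) : E3 :=
  !₂[radialSpeed r c s,
    r * radius r c s ^ (r - 1) * radialSpeed r c s * Real.cos θ -
      c / radius r c s ^ r * Real.sin θ,
    r * radius r c s ^ (r - 1) * radialSpeed r c s * Real.sin θ +
      c / radius r c s ^ r * Real.cos θ]

theorem exists_isClairautCurve {r c : ℝ} (hr : 1 < r) (hc : c ≠ 0) (s₀ θ₀ : ℝ) :
    ∃ u θ : ℝ → ℝ, IsClairautCurve r c u θ ∧ θ 0 = θ₀ ∧ u 0 = s₀ ∧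
      ∀ t, turningTime r c (u t) = turningTime r c s₀ + t := by
  obtain ⟨f, hf1, hf2, hf3⟩ := exists_inverse_turningTime hr hc
  set T := turningTime r c s₀
  have hu : ∀ t, HasDerivAt (fun t => f (T + t)) (timeDensity r (c ^ 2 + f (T + t) ^ 2))⁻¹ t :=
    fun t => (hf3 (T + t)).comp_const_add T t
  have hcont : Continuous fun t => f (T + t) :=
    continuous_iff_continuousAt.2 fun t => (hu t).continuousAt
  have hg : Continuous fun t => c / (c ^ 2 + f (T + t) ^ 2) :=
    continuous_const.div (continuous_const.add (hcont.pow 2)) fun t => by positivity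
  refine ⟨fun t => f (T + t), fun t => θ₀ + ∫ s in (0 : ℝ)..t, c / (c ^ 2 + f (T + s) ^ 2),
    ⟨hu, fun t => ?_⟩, by simp, by simp [T, hf1], fun t => hf2 _⟩
  exact ((hg.integral_hasStrictDerivAt 0 t).hasDerivAt).const_add θ₀

namespace IsClairautCurve

variable {r c : ℝ} {u θ : ℝ → ℝ}

theorem contDiff_momentum (h : IsClairautCurve r c u θ) (hr : 1 < r) (hc : c ≠ 0) :
    ContDiff ℝ 2 u :=
  contDiff_two_of_hasDerivAt_comp
    ((contDiff_timeDensity hr hc).inv fun _ => (timeDensity_pos _ _).ne') h.hasDerivAt_momentum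

theorem contDiff_angle (h : IsClairautCurve r c u θ) (hr : 1 < r) (hc : c ≠ 0) :
    ContDiff ℝ 2 θ := by
  have hu : ContDiff ℝ 1 u := (h.contDiff_momentum hr hc).of_le (by norm_num)
  rw [show (2 : WithTop ℕ∞) = 1 + 1 by norm_num, contDiff_succ_iff_deriv,
    show deriv θ = fun t => c / (c ^ 2 + u t ^ 2) from funext fun t => (h.hasDerivAt_angle t).deriv]
  exact ⟨fun t => (h.hasDerivAt_angle t).differentiableAt, by simp,
    contDiff_const.div (by fun_prop) fun t => by positivity⟩

theorem contDiff_surfacePoint (h : IsClairautCurve r c u θ) (hr : 1 < r) (hc : c ≠ 0) :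
    ContDiff ℝ 2 fun t => surfacePoint r (radius r c (u t)) (θ t) := by
  have hu := h.contDiff_momentum hr hc
  have hθ := h.contDiff_angle hr hc
  have hx : ContDiff ℝ 2 fun t => radius r c (u t) := by
    unfold radius
    exact ContDiff.rpow_const_of_ne (by fun_prop) fun t => by positivity
  have hρ : ContDiff ℝ 2 fun t => radius r c (u t) ^ r :=
    hx.rpow_const_of_ne fun t => (radius_pos hc).ne'
  exact contDiff_toE3 hx (hρ.mul (Real.contDiff_cos.comp hθ)) (hρ.mul (Real.contDiff_sin.comp hθ))

theorem hasDerivAt_radius_rpow (h : IsClairautCurve r c u θ) (hr : 1 < r) (hc : c ≠ 0) (t : ℝ) :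
    HasDerivAt (fun t => radius r c (u t) ^ r)
      (r * radius r c (u t) ^ (r - 1) * radialSpeed r c (u t)) t :=
  ((hasDerivAt_radius hr hc (h.hasDerivAt_momentum t)).rpow_const
    (Or.inl (radius_pos hc).ne')).congr_deriv (by ring)

theorem hasDerivAt_angle' (h : IsClairautCurve r c u θ) (hr : 1 < r) (hc : c ≠ 0) (t : ℝ) :
    HasDerivAt θ (c / (radius r c (u t) ^ r) ^ 2) t := by
  rw [radius_sq hr hc]
  exact h.hasDerivAt_angle t

theorem hasDerivAt_surfacePoint (h : IsClairautCurve r c u θ) (hr : 1 < r) (hc : c ≠ 0) (t : ℝ) :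
    HasDerivAt (fun t => surfacePoint r (radius r c (u t)) (θ t))
      (clairautVelocity r c (u t) (θ t)) t := by
  have hx := hasDerivAt_radius hr hc (h.hasDerivAt_momentum t)
  have hρ := h.hasDerivAt_radius_rpow hr hc t
  have hθ := h.hasDerivAt_angle' hr hc t
  have hpos : 0 < radius r c (u t) ^ r := Real.rpow_pos_of_pos (radius_pos hc) _
  refine hasDerivAt_toE3 hx ((hρ.fun_mul hθ.cos).congr_deriv ?_)
    ((hρ.fun_mul hθ.sin).congr_deriv ?_)
  · field_simp
    ring
  · field_simp

/-- In the plane orthogonal to the axis the angular acceleration vanishes, as `ρ²θ' = c`. The axial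
component then matches by the formula for `radialAcceleration`. -/
theorem hasDerivAt_velocity (h : IsClairautCurve r c u θ) (hr : 1 < r) (hc : c ≠ 0) (t : ℝ) :
    ∃ l : ℝ, HasDerivAt (fun t => clairautVelocity r c (u t) (θ t))
      (l • normalVector r (surfacePoint r (radius r c (u t)) (θ t))) t := by
  have hxpos : 0 < radius r c (u t) := radius_pos hc
  have hx := hasDerivAt_radius hr hc (h.hasDerivAt_momentum t)
  have hA := hasDerivAt_radialSpeed hr hc (h.hasDerivAt_momentum t)
  have hρ := h.hasDerivAt_radius_rpow hr hc t
  have hP : HasDerivAt (fun t => radius r c (u t) ^ (r - 1))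
      (radialSpeed r c (u t) * (r - 1) * radius r c (u t) ^ (r - 1 - 1)) t :=
    hx.rpow_const (Or.inl hxpos.ne')
  have hθ := h.hasDerivAt_angle' hr hc t
  have hρpos : 0 < radius r c (u t) ^ r := Real.rpow_pos_of_pos hxpos _
  have hB := (hP.const_mul r).fun_mul hA
  have hC := (hasDerivAt_const t c).fun_div hρ hρpos.ne'
  have h1 := (hB.fun_mul hθ.cos).fun_sub (hC.fun_mul hθ.sin)
  have h2 := (hB.fun_mul hθ.sin).fun_add (hC.fun_mul hθ.cos)
  -- The multiplier is `(ρ'' - ρ θ'²) / ρ`, with `ρ θ'² = c² / ρ³`.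
  refine ⟨(r * (radialSpeed r c (u t) * (r - 1) * radius r c (u t) ^ (r - 1 - 1)) *
    radialSpeed r c (u t) + r * radius r c (u t) ^ (r - 1) * radialAcceleration r c (u t) -
      c ^ 2 / (radius r c (u t) ^ r) ^ 3) / radius r c (u t) ^ r,
    (hasDerivAt_toE3 hA h1 h2).congr_deriv ?_⟩
  have hE0 : 0 < 1 + (r * radius r c (u t) ^ (r - 1)) ^ 2 := by positivity
  have hEsq := Real.sq_sqrt hE0.le
  have hacc : radialAcceleration r c (u t) * (1 + (r * radius r c (u t) ^ (r - 1)) ^ 2) =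
      r * radius r c (u t) ^ (r - 1) * (c ^ 2 / (radius r c (u t) ^ r) ^ 3 -
        r * (r - 1) * radius r c (u t) ^ (r - 2) * radialSpeed r c (u t) ^ 2) := by
    rw [radialAcceleration, hEsq]
    field_simp
  rw [show r - 2 = r - 1 - 1 by ring] at hacc
  have hn : radius r c (u t) ^ (2 * r - 1) =
      radius r c (u t) ^ r * radius r c (u t) ^ (r - 1) := by
    rw [← Real.rpow_add hxpos]
    congr 1
    ring
  ext i
  fin_cases i
  · simp only [normalVector, surfacePoint, PiLp.smul_apply, smul_eq_mul, Matrix.cons_val,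
      Fin.zero_eta, hn]
    generalize radialAcceleration r c (u t) = D at *
    field_simp at hacc ⊢
    linear_combination hacc
  · simp only [normalVector, surfacePoint, PiLp.smul_apply, smul_eq_mul, Matrix.cons_val,
      Fin.mk_one]
    field_simp
    ring
  · simp only [normalVector, surfacePoint, PiLp.smul_apply, smul_eq_mul, Matrix.cons_val,
      Fin.reduceFinMk]
    field_simp
    ring

theorem isGeodesicOn (h : IsClairautCurve r c u θ) (hr : 1 < r) (hc : c ≠ 0) {τ : ℝ}
    (hτ : 0 < τ) :
    IsGeodesicOn r (fun t => surfacePoint r (radius r c (u t)) (θ t)) (Icc 0 τ) := by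
  have hU := uniqueDiffOn_Icc hτ
  have hvel : EqOn (derivWithin (fun t => surfacePoint r (radius r c (u t)) (θ t)) (Icc 0 τ))
      (fun t => clairautVelocity r c (u t) (θ t)) (Icc 0 τ) := fun t ht =>
    (h.hasDerivAt_surfacePoint hr hc t).hasDerivWithinAt.derivWithin (hU t ht)
  refine ⟨(h.contDiff_surfacePoint hr hc).contDiffOn, fun t _ => surfacePoint_mem (radius_pos hc),
    fun t ht => ?_⟩
  obtain ⟨l, hl⟩ := h.hasDerivAt_velocity hr hc t
  refine ⟨l, ?_⟩
  rw [derivWithin_congr hvel (hvel ht)]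
  exact hl.hasDerivWithinAt.derivWithin (hU t ht)

end IsClairautCurve

/-! ### Existence of the first return -/

theorem radius_eq_iff {r d c s : ℝ} (hr : 1 < r) (hd : 0 < d) (hc : c ≠ 0) :
    radius r c s = d ↔ c ^ 2 + s ^ 2 = (d ^ r) ^ 2 := by
  rw [← radius_rpow hr, ← mul_rpow_sub_one hd, ← rpow_two_mul hd,
    Real.rpow_left_inj (radius_pos hc).le hd.le (by positivity)]

theorem isFirstReturnTime_returnTime {r d : ℝ} {v : Real.Angle × ℝ} (hr : 1 < r) (hd : 0 < d)
    (hv : |v.2| < Real.pi / 2) (hv0 : v.2 ≠ 0) :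
    IsFirstReturnTime r d v (returnTime r d v.2) := by
  obtain ⟨y, β⟩ := v
  induction y using Real.Angle.induction_on with | _ y => ?_
  simp only at hv hv0 ⊢
  have hc := rpow_mul_sin_ne_zero (r := r) hd hv hv0
  have hs := rpow_mul_cos_pos (r := r) hd hv
  have hT := returnTime_pos hr hd hv hv0
  have hcs : (d ^ r * Real.sin β) ^ 2 + (d ^ r * Real.cos β) ^ 2 = (d ^ r) ^ 2 := by
    linear_combination (d ^ r) ^ 2 * Real.sin_sq_add_cos_sq β
  have hTdef : returnTime r d β = 2 * turningTime r (d ^ r * Real.sin β) (d ^ r * Real.cos β) := rfl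
  have hsc : d ^ r * Real.sin β / d ^ r = Real.sin β := by
    have : 0 < d ^ r := by positivity
    field_simp
  obtain ⟨u, θ, hcurve, hθ0, hu0, hu⟩ := exists_isClairautCurve hr hc (-(d ^ r * Real.cos β)) y
  set c := d ^ r * Real.sin β
  set s := d ^ r * Real.cos β with hsdef
  rw [turningTime_neg] at hu
  have hmono := strictMono_turningTime hr hc
  have hx0 : radius r c (u 0) = d := by
    rw [radius_eq_iff hr hd hc, hu0, neg_sq, hcs]
  have hend : u (returnTime r d β) = s := hmono.injective (by rw [hu, hTdef]; ring)
  refine ⟨hT, fun t => surfacePoint r (radius r c (u t)) (θ t),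
    hcurve.isGeodesicOn hr hc hT, ?_, ?_, ⟨surfacePoint_mem (radius_pos hc), ?_⟩, ?_⟩
  · simp [surfacePoint, basePoint, hx0, hθ0]
  · rw [(hcurve.hasDerivAt_surfacePoint hr hc 0).hasDerivWithinAt.derivWithin
      (uniqueDiffOn_Icc hT 0 ⟨le_rfl, hT.le⟩)]
    have hspeed : radialSpeed r c (u 0) = initialVector r d (y, β) 0 := by
      have : 0 < d ^ r := by positivity
      have : 0 < √(1 + (r * d ^ (r - 1)) ^ 2) := Real.sqrt_pos.2 (by positivity)
      rw [initialVector_zero, radialSpeed, hx0, hu0, hsdef]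
      field_simp
    ext i
    fin_cases i
    · simp only [clairautVelocity, Matrix.cons_val, Fin.zero_eta, hspeed]
    · simp only [clairautVelocity, Matrix.cons_val, Fin.mk_one, hspeed, initialVector_one, hx0, hθ0,
        initialVector_zero, Real.Angle.cos_coe, Real.Angle.sin_coe, hsc]
      ring
    · simp only [clairautVelocity, Matrix.cons_val, Fin.reduceFinMk, hspeed, initialVector_two, hx0,
        hθ0, initialVector_zero, Real.Angle.cos_coe, Real.Angle.sin_coe, hsc]
      ring
  · simp only [surfacePoint, Matrix.cons_val]
    rw [radius_eq_iff hr hd hc, hend, hcs]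
  · rintro t ht ⟨-, hpar⟩
    simp only [surfacePoint, Matrix.cons_val] at hpar
    rw [radius_eq_iff hr hd hc, ← hcs] at hpar
    -- The momentum increases strictly from `-s` to `s`, so `u t ^ 2 < s ^ 2` at interior times and
    -- the parallel is not met.
    have hlt1 : -s < u t := hmono.lt_iff_lt.1 (by rw [hu, turningTime_neg]; linarith [ht.1])
    have hlt2 : u t < s := hmono.lt_iff_lt.1 (by rw [hu]; linarith [ht.2])
    nlinarith

theorem isFirstReturnTime_iff {r d τ : ℝ} {v : Real.Angle × ℝ} (hr : 1 < r) (hd : 0 < d)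
    (hv : |v.2| < Real.pi / 2) (hv0 : v.2 ≠ 0) :
    IsFirstReturnTime r d v τ ↔ τ = returnTime r d v.2 := by
  refine ⟨fun h => h.eq_returnTime hr hd hv hv0, ?_⟩
  rintro rfl
  exact isFirstReturnTime_returnTime hr hd hv hv0

/-- The set of first return times is a singleton, so its infimum is attained. -/
theorem roof_eq_returnTime {r d : ℝ} {v : Real.Angle × ℝ} (hr : 1 < r) (hd : 0 < d)
    (hv : |v.2| < Real.pi / 2) (hv0 : v.2 ≠ 0) : roof r d v = returnTime r d v.2 := by
  simp [roof, isFirstReturnTime_iff hr hd hv hv0]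

/-! ### Hölder estimates on the homogeneity strips -/

/-- The width of the `k`-th homogeneity strip. -/
theorem one_div_rpow_sub_le {ν k : ℝ} (hν : 0 < ν) (hk : 1 ≤ k) :
    1 / k ^ ν - 1 / (k + 1) ^ ν ≤ ν * k ^ (-(ν + 1)) := by
  have hk0 : 0 < k := by linarith
  -- A Bernoulli-type inequality for every `ν > 0`, from `log x ≤ x - 1` and `1 + x ≤ exp x`.
  have h1 : 1 - ν / k ≤ (k / (k + 1)) ^ ν := by
    have hlog : -(1 / k) ≤ Real.log (k / (k + 1)) := by
      have h := Real.log_le_sub_one_of_pos (x := (k + 1) / k) (by positivity)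
      rw [← inv_div (k + 1) k, Real.log_inv]
      have : (k + 1) / k - 1 = 1 / k := by field_simp; ring
      linarith
    rw [Real.rpow_def_of_pos (by positivity)]
    have h := Real.add_one_le_exp (Real.log (k / (k + 1)) * ν)
    have : -(1 / k) * ν ≤ Real.log (k / (k + 1)) * ν := by gcongr
    have : ν / k = 1 / k * ν := by ring
    linarith
  rw [Real.div_rpow hk0.le (by linarith)] at h1
  have h2 : k ^ (-(ν + 1)) = 1 / k ^ ν * (1 / k) := by
    rw [Real.rpow_neg hk0.le, Real.rpow_add_one hk0.ne']
    field_simp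
  have hp : 0 < k ^ ν := by positivity
  have h3 : 1 / (k + 1) ^ ν = 1 / k ^ ν * (k ^ ν / (k + 1) ^ ν) := by
    field_simp
  rw [h2, h3]
  have : 1 / k ^ ν * (1 - ν / k) ≤ 1 / k ^ ν * (k ^ ν / (k + 1) ^ ν) := by gcongr
  have e : ν * (1 / k ^ ν * (1 / k)) = 1 / k ^ ν * (ν / k) := by ring
  rw [e]
  linarith

/-- On a homogeneity strip the relative increment is controlled by a power of the increment. -/
theorem div_le_rpow_of_mem_strip {ν α k b₁ b₂ : ℝ} (hν : 0 < ν) (hα₁ : α < 1 / (ν + 1))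
    (hk : 1 ≤ k) (h₁ : 1 / (k + 1) ^ ν < b₁) (h : b₁ ≤ b₂) (h₂ : b₂ < 1 / k ^ ν) (hα₀ : 0 < α) :
    (b₂ - b₁) / b₁ ≤ ν ^ (1 - α) * 2 ^ ν * (b₂ - b₁) ^ α := by
  have hk0 : 0 < k := by linarith
  have hα : α < 1 := hα₁.trans_le ((div_le_one (by linarith)).2 (by linarith))
  have hb : 0 < b₁ := lt_trans (by positivity) h₁
  have hD : 0 ≤ b₂ - b₁ := by linarith
  have hwidth : b₂ - b₁ ≤ ν * k ^ (-(ν + 1)) := by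
    have := one_div_rpow_sub_le hν hk
    linarith
  have hinv : b₁⁻¹ ≤ 2 ^ ν * k ^ ν := by
    rw [← Real.mul_rpow (by norm_num) hk0.le]
    calc b₁⁻¹ ≤ (1 / (k + 1) ^ ν)⁻¹ := by gcongr
      _ = (k + 1) ^ ν := by rw [one_div, inv_inv]
      _ ≤ (2 * k) ^ ν := by gcongr; linarith
  have hpow : (b₂ - b₁) ^ (1 - α) ≤ ν ^ (1 - α) * k ^ (-(ν + 1) * (1 - α)) := by
    rw [Real.rpow_mul hk0.le, ← Real.mul_rpow hν.le (by positivity)]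
    gcongr
  -- The total exponent is `α (ν + 1) - 1`, negative exactly when `α < 1 / (ν + 1)`.
  have hkpow : k ^ (-(ν + 1) * (1 - α)) * k ^ ν ≤ 1 := by
    rw [← Real.rpow_add hk0]
    refine Real.rpow_le_one_of_one_le_of_nonpos hk ?_
    rw [lt_div_iff₀ (by linarith)] at hα₁
    linarith
  have hsplit : b₂ - b₁ = (b₂ - b₁) ^ α * (b₂ - b₁) ^ (1 - α) := by
    rw [← Real.rpow_add_of_nonneg hD hα₀.le (by linarith), add_sub_cancel, Real.rpow_one]
  calc (b₂ - b₁) / b₁ = (b₂ - b₁) ^ α * ((b₂ - b₁) ^ (1 - α) * b₁⁻¹) := by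
        rw [← mul_assoc, ← hsplit, div_eq_mul_inv]
    _ ≤ (b₂ - b₁) ^ α * ((ν ^ (1 - α) * k ^ (-(ν + 1) * (1 - α))) * (2 ^ ν * k ^ ν)) := by gcongr
    _ = ν ^ (1 - α) * 2 ^ ν * (b₂ - b₁) ^ α * (k ^ (-(ν + 1) * (1 - α)) * k ^ ν) := by ring
    _ ≤ ν ^ (1 - α) * 2 ^ ν * (b₂ - b₁) ^ α * 1 := by gcongr
    _ = _ := mul_one _

/-- The Hölder constant of the return time on the homogeneity strips. -/
def stripHolderConst (r d ν α : ℝ) : ℝ :=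
  2 * (d ^ r * timeDensity r ((d ^ r * Real.cos 1) ^ 2) + 2 * (d ^ r + d)) * (ν ^ (1 - α) * 2 ^ ν)

theorem stripHolderConst_nonneg {r d ν α : ℝ} (hd : 0 < d) (hν : 0 < ν) :
    0 ≤ stripHolderConst r d ν α := by
  have := timeDensity_pos r ((d ^ r * Real.cos 1) ^ 2)
  unfold stripHolderConst
  positivity

theorem abs_returnTime_sub_le_rpow {r d ν α k β₁ β₂ : ℝ} (hr : 1 < r) (hd : 0 < d) (hν : 0 < ν)
    (hα₀ : 0 < α) (hα₁ : α < 1 / (ν + 1)) (hk : 1 ≤ k)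
    (h₁ : 1 / (k + 1) ^ ν < |β₁| ∧ |β₁| < 1 / k ^ ν)
    (h₂ : 1 / (k + 1) ^ ν < |β₂| ∧ |β₂| < 1 / k ^ ν) :
    |returnTime r d β₁ - returnTime r d β₂| ≤ stripHolderConst r d ν α * |β₁ - β₂| ^ α := by
  wlog hle : |β₁| ≤ |β₂| generalizing β₁ β₂
  · rw [abs_sub_comm, abs_sub_comm β₁]
    exact this h₂ h₁ (le_of_not_ge hle)
  -- Evenness in `β` treats the two components of the strip together, since `||β₁| - |β₂|| ≤ |β₁ -
  -- β₂|`.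
  rw [← returnTime_abs r d β₁, ← returnTime_abs r d β₂]
  have hpos : 0 < |β₁| := lt_trans (by positivity) h₁.1
  have hone : |β₂| ≤ 1 := by
    refine h₂.2.le.trans ?_
    rw [div_le_one (by positivity)]
    exact Real.one_le_rpow hk hν.le
  have hdist : |β₂| - |β₁| ≤ |β₁ - β₂| := by
    rw [abs_sub_comm]
    exact abs_sub_abs_le_abs_sub _ _
  have hT := timeDensity_pos r ((d ^ r * Real.cos 1) ^ 2)
  calc _ ≤ _ := abs_returnTime_sub_le hr hd hpos hle hone
    _ ≤ 2 * (d ^ r * timeDensity r ((d ^ r * Real.cos 1) ^ 2) + 2 * (d ^ r + d)) *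
        (ν ^ (1 - α) * 2 ^ ν * (|β₂| - |β₁|) ^ α) := by
      gcongr
      exact div_le_rpow_of_mem_strip hν hα₁ hk h₁.1 hle h₂.2 hα₀
    _ = stripHolderConst r d ν α * (|β₂| - |β₁|) ^ α := by rw [stripHolderConst]; ring
    _ ≤ _ := by
      have := stripHolderConst_nonneg (r := r) (α := α) hd hν
      have : 0 ≤ |β₂| - |β₁| := by linarith
      gcongr

theorem ne_zero_of_mem_strip {ν : ℝ} {k : ℕ} {v : Real.Angle × ℝ} (hv : v ∈ strip ν k) :
    v.2 ≠ 0 := by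
  have h : 0 < |v.2| := lt_of_le_of_lt (by positivity) hv.2.1
  exact abs_pos.1 h

theorem holderWith_roof_strip {r d ν : ℝ} {α : ℝ≥0} {k : ℕ} (hr : 1 < r) (hd : 0 < d) (hν : 0 < ν)
    (hα₀ : 0 < α) (hα₁ : (α : ℝ) < 1 / (ν + 1)) (hk : 1 ≤ k) :
    HolderWith (stripHolderConst r d ν α).toNNReal α (fun p : strip ν k => roof r d p) := by
  intro p q
  have hα₀' : (0 : ℝ) < α := by exact_mod_cast hα₀
  have hC := stripHolderConst_nonneg (r := r) (α := α) hd hν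
  beta_reduce
  rw [roof_eq_returnTime hr hd p.2.1 (ne_zero_of_mem_strip p.2),
    roof_eq_returnTime hr hd q.2.1 (ne_zero_of_mem_strip q.2), edist_dist, edist_dist,
    ENNReal.ofReal_rpow_of_nonneg dist_nonneg hα₀'.le,
    show ((stripHolderConst r d ν α).toNNReal : ℝ≥0∞) = ENNReal.ofReal (stripHolderConst r d ν α)
      from rfl, ← ENNReal.ofReal_mul hC]
  refine ENNReal.ofReal_le_ofReal ?_
  rw [Real.dist_eq]
  refine (abs_returnTime_sub_le_rpow hr hd hν hα₀' hα₁ (k := k) (by exact_mod_cast hk)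
    p.2.2 q.2.2).trans ?_
  gcongr
  rw [← Real.dist_eq]
  -- The product carries the maximum distance, which dominates the one in `β`.
  exact le_max_right _ _

theorem holderNorm_roof_le {r d ν : ℝ} {α : ℝ≥0} {k : ℕ} (hr : 1 < r) (hd : 0 < d) (hν : 0 < ν)
    (hα₀ : 0 < α) (hα₁ : (α : ℝ) < 1 / (ν + 1)) (hk : 1 ≤ k) :
    holderNorm α (roof r d) (strip ν k) ≤
      ENNReal.ofReal (2 * (d ^ r + d)) + (stripHolderConst r d ν α).toNNReal := by
  refine add_le_add (iSup₂_le fun v hv => ?_)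
    (holderWith_roof_strip hr hd hν hα₀ hα₁ hk).eHolderNorm_le
  have h0 := ne_zero_of_mem_strip hv
  rw [roof_eq_returnTime hr hd hv.1 h0, Real.enorm_of_nonneg (returnTime_pos hr hd hv.1 h0).le]
  exact ENNReal.ofReal_le_ofReal (returnTime_le hr hd hv.1 h0)

end CuspSurface

end

theorem propositionp (r : ℝ) (hr : 3 < r) (ν : ℝ) (hν : 0 < ν)
    (α : ℝ≥0) (hα₀ : 0 < α) (hα₁ : (α : ℝ) < 1 / (ν + 1)) :
    ∃ δ : ℝ, 0 < δ ∧ ∀ d₀ : ℝ, 0 < d₀ → d₀ < δ →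
      (∀ v ∈ CuspSurface.crossSection \ CuspSurface.singularSet, ∀ τ : ℝ,
        CuspSurface.IsFirstReturnTime r d₀ v τ ↔ τ = CuspSurface.roof r d₀ v) ∧
      (⨆ k : ℕ, ⨆ _ : 1 ≤ k,
        CuspSurface.holderNorm α (CuspSurface.roof r d₀) (CuspSurface.strip ν k)) < ∞ := by
  have hr1 : 1 < r := by linarith
  -- The bounds are finite and independent of `k` for each `d₀ > 0`, so any positive `δ` serves.
  refine ⟨1, one_pos, fun d₀ hd _ => ⟨fun v hv τ => ?_, ?_⟩⟩
  · have h0 : v.2 ≠ 0 := fun h => hv.2 ⟨hv.1, h⟩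
    rw [CuspSurface.roof_eq_returnTime hr1 hd hv.1 h0]
    exact CuspSurface.isFirstReturnTime_iff hr1 hd hv.1 h0
  · refine lt_of_le_of_lt (iSup_le fun k => iSup_le fun hk =>
      CuspSurface.holderNorm_roof_le hr1 hd hν hα₀ hα₁ hk) ?_
    exact ENNReal.add_lt_top.2 ⟨ENNReal.ofReal_lt_top, ENNReal.coe_lt_top⟩
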